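/- Let $q$ be a power of an odd prime, $\psi$ a non-trivial additive character $\mathbb{F}_q\to\mathbb{C}^\ast$, and $\varepsilon\in\mathbb{F}_q^\ast$ a non-square. For a symplectic space $(W,\langle\,,\rangle)$ over $\mathbb{F}_q$ let $H=W\times\mathbb{F}_q$ be the Heisenberg group, with $(w,z)(w',z')=(w+w',z+z'+\tfrac12\langle w,w'\rangle)$. A Heisenberg representation with central character $\psi$ is an irreducible complex representation $\pi_\psi$ of $H$ with $\pi_\psi(0,z)=\psi(z)I$; it is unique up to isomorphism. The oscillator representation of $Sp(W)$ attached to $\psi$ is the representation $\omega$ of $Sp(W)$ on the space of $\pi_\psi$ such that $\omega(g)\pi_\psi(w,z)\omega(g)^{-1}=\pi_\psi(gw,z)$ for all $g\in Sp(W)$ and $(w,z)\in H$. It is unique up to isomorphism, except when $q=3$ and $\dim W=2$; in that case the canonical one is meant, for which every $g\in Sp(W)$ that fixes a vector $w\neq 0$ also fixes every vector which is fixed by $\pi_\psi(w,0)$. Let $V=\mathbb{F}_q^2$ with the symplectic form $\langle v,v'\rangle_V=v_1v_2'-v_2v_1'$, and let $G=SL_2(\mathbb{F}_q)=Sp(V)$.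 For a finite-dimensional space $U$ over $\mathbb{F}_q$ with a non-degenerate symmetric bilinear form $\beta$, let $\omega_{U\otimes V}$ be the oscillator representation attached to $\psi$ of $Sp(U\otimes V)$, where $U\otimes V$ carries the form $\beta\otimes\langle\,,\rangle_V$; the group $G$ acts on $U\otimes V$ through the second factor, and this gives a homomorphism $G\to Sp(U\otimes V)$ and a restriction $\omega_{U\otimes V|G}$. For $U=\mathbb{F}_q$ with $\beta(x,x)=x^2$, respectively $\beta(x,x)=\varepsilon x^2$, write $\omega_{\psi+}$, respectively $\omega_{\psi-}$, for $\omega_{U\otimes V|G}$. Proposition. Assume that $\dim U=2$. If $(U,\beta)$ is a hyperbolic plane, that is, isometric to $\mathbb{F}_q^2$ with the form $x^2-y^2$, then, as representations of $G$, $$\omega_{U\otimes V|G}\;\simeq\;\begin{cases}\omega_{\psi+}\otimes\omega_{\psi+} & \text{if } q\equiv 1 \bmod 4,\\ \omega_{\psi+}\otimes\omega_{\psi-} & \text{if } q\equiv 3 \bmod 4.\end{cases}$$ If $(U,\beta)$ is an anisotropic plane, that is, isometric to $\mathbb{F}_q^2$ with the form $x^2-\varepsilon y^2$, then, as representations of $G$,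 $$\omega_{U\otimes V|G}\;\simeq\;\begin{cases}\omega_{\psi+}\otimes\omega_{\psi-} & \text{if } q\equiv 1 \bmod 4,\\ \omega_{\psi+}\otimes\omega_{\psi+} & \text{if } q\equiv 3 \bmod 4.\end{cases}$$ -/

import Mathlib

open scoped TensorProduct

noncomputable section

/-! ### Symplectic groups and Heisenberg groups of a bilinear form -/

section General

variable {F W : Type*} [Field F] [AddCommGroup W] [Module F W]

/-- The group `Sp(W)` of linear automorphisms of `W` which preserve the form `B`. -/
def SpGroup (B : LinearMap.BilinForm F W) : Subgroup (W ≃ₗ[F] W) where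
  carrier := {g | ∀ v w, B (g v) (g w) = B v w}
  one_mem' := fun _ _ => rfl
  mul_mem' := fun {a b} ha hb v w => by
    simp only [Set.mem_ofPred_eq, LinearEquiv.mul_apply] at *
    rw [ha, hb]
  inv_mem' := fun {a} ha v w => by
    simp only [Set.mem_ofPred_eq] at *
    rw [← ha (a⁻¹ v) (a⁻¹ w)]
    simp only [← LinearEquiv.mul_apply, mul_inv_cancel, LinearEquiv.coe_one, id_eq]

/-- The underlying set `W × F` of the Heisenberg group attached to `(W, B)`. -/
@[ext]
structure Heisenberg (B : LinearMap.BilinForm F W) where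
  /-- the component in `W` -/
  vec : W
  /-- the central component -/
  cen : F

namespace Heisenberg

variable {B : LinearMap.BilinForm F W}

instance : One (Heisenberg B) := ⟨⟨0, 0⟩⟩

/-- `(w, z) (w', z') = (w + w', z + z' + ½ ⟨w, w'⟩)`. -/
instance : Mul (Heisenberg B) :=
  ⟨fun h k => ⟨h.vec + k.vec, h.cen + k.cen + (2 : F)⁻¹ * B h.vec k.vec⟩⟩

/-- The correction term vanishes when `B` is alternating. -/
instance : Inv (Heisenberg B) :=
  ⟨fun h => ⟨-h.vec, -h.cen + (2 : F)⁻¹ * B h.vec h.vec⟩⟩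

@[simp] lemma one_vec : (1 : Heisenberg B).vec = 0 := rfl
@[simp] lemma one_cen : (1 : Heisenberg B).cen = 0 := rfl
@[simp] lemma mul_vec (h k : Heisenberg B) : (h * k).vec = h.vec + k.vec := rfl
@[simp] lemma mul_cen (h k : Heisenberg B) :
    (h * k).cen = h.cen + k.cen + (2 : F)⁻¹ * B h.vec k.vec := rfl
@[simp] lemma inv_vec (h : Heisenberg B) : h⁻¹.vec = -h.vec := rfl
@[simp] lemma inv_cen (h : Heisenberg B) :
    h⁻¹.cen = -h.cen + (2 : F)⁻¹ * B h.vec h.vec := rfl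

instance : Group (Heisenberg B) :=
  Group.ofLeftAxioms
    (fun a b c => by
      ext
      · simp [add_assoc]
      · simp; ring)
    (fun a => by ext <;> simp)
    (fun a => by ext <;> simp)

/-- The action `g (w, z) = (g w, z)` of `Sp(W)` on the Heisenberg group. -/
def act (g : SpGroup B) (h : Heisenberg B) : Heisenberg B :=
  ⟨(g : W ≃ₗ[F] W) h.vec, h.cen⟩

end Heisenberg

/-! ### Heisenberg and oscillator representations -/

variable {B : LinearMap.BilinForm F W} {E : Type*} [AddCommGroup E] [Module ℂ E]

/-- `π` is a Heisenberg representation with central character `ψ`: it is irreducible, and the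
central element `(0, z)` acts by the scalar `ψ z`. -/
structure IsHeisenbergRep (ψ : AddChar F ℂ) (π : Representation ℂ (Heisenberg B) E) : Prop where
  irreducible : π.IsIrreducible
  central : ∀ (z : F) (v : E), π ⟨0, z⟩ v = ψ z • v

/-- `ω` is the oscillator representation of `Sp(W)` attached to the central character `ψ`: it is
realized on the space of a Heisenberg representation `π` with central character `ψ`, and
`ω(g) π(h) ω(g)⁻¹ = π(g(h))` for all `g` and `h`.

This condition determines `ω` except when `#F = 3` and `dim W = 2`, where three such `ω` exist.
They differ by the characters of `SL₂(𝔽₃)`, and the last clause selects the canonical one, for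
which a transvection fixing `w ≠ 0` fixes the vectors which are invariant under the Lagrangian line
spanned by `w`. In the Schrödinger model on functions on a complementary line this is the usual
normalization: unipotent elements act by `f(y) ↦ ψ(½ A(y,y)) f(y)`, so they fix the delta function
at `0`. -/
def IsOscillatorRep (ψ : AddChar F ℂ) (ω : Representation ℂ (SpGroup B) E) : Prop :=
  ∃ π : Representation ℂ (Heisenberg B) E,
    IsHeisenbergRep ψ π ∧
    (∀ (g : SpGroup B) (h : Heisenberg B), ω g ∘ₗ π h ∘ₗ ω g⁻¹ = π (Heisenberg.act g h)) ∧
    (Nat.card F = 3 → Module.finrank F W = 2 →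
      ∀ (g : SpGroup B) (w : W) (v : E), w ≠ 0 → (g : W ≃ₗ[F] W) w = w →
        π ⟨w, 0⟩ v = v → ω g v = v)

end General

/-! ### The dual pair -/

section DualPair

variable (F : Type*) [Field F]

/-- The symplectic form `⟨v, v'⟩ = v₀ v'₁ - v₁ v'₀` on the plane `V = F²`. -/
def sympV : LinearMap.BilinForm F (Fin 2 → F) := Matrix.toBilin' !![0, 1; -1, 0]

variable {F}

/-- The form `c x x'` on the line `F`. -/
def lineForm (c : F) : LinearMap.BilinForm F F := c • LinearMap.mul F F

/-- The form `x x' - c y y'` on the plane `F²`. -/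
def planeForm (c : F) : LinearMap.BilinForm F (Fin 2 → F) := Matrix.toBilin' !![1, 0; 0, -c]

variable {U : Type*} [AddCommGroup U] [Module F U]

/-- The form `β ⊗ ⟨ , ⟩` on `U ⊗ V`. -/
def tensorForm (β : LinearMap.BilinForm F U) : LinearMap.BilinForm F (U ⊗[F] (Fin 2 → F)) :=
  LinearMap.BilinForm.tmul β (sympV F)

lemma sympV_apply (v w : Fin 2 → F) : sympV F v w = v 0 * w 1 - v 1 * w 0 := by
  simp [sympV, Matrix.toBilin'_apply, Fin.sum_univ_two]
  ring

lemma sympV_toLin' (g : Matrix.SpecialLinearGroup (Fin 2) F) (v w : Fin 2 → F) :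
    sympV F (Matrix.SpecialLinearGroup.toLin' g v) (Matrix.SpecialLinearGroup.toLin' g w) =
      sympV F v w := by
  have hd : g.1 0 0 * g.1 1 1 - g.1 0 1 * g.1 1 0 = 1 := by
    rw [← Matrix.det_fin_two]; exact g.2
  simp only [sympV_apply, Matrix.SpecialLinearGroup.toLin'_apply, Matrix.toLin'_apply,
    Matrix.mulVec, dotProduct, Fin.sum_univ_two]
  linear_combination (v 0 * w 1 - v 1 * w 0) * hd

/-- The embedding of `G = SL₂(F)` in `Sp(U ⊗ V)` through the action on the second factor. -/
def slToSp (β : LinearMap.BilinForm F U) :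
    Matrix.SpecialLinearGroup (Fin 2) F →* SpGroup (tensorForm β) where
  toFun g := ⟨TensorProduct.congr (LinearEquiv.refl F U) (Matrix.SpecialLinearGroup.toLin' g), by
    intro x y
    induction x using TensorProduct.induction_on with
    | zero => simp
    | add x x' hx hx' => simp only [map_add, LinearMap.add_apply, hx, hx']
    | tmul u v =>
      induction y using TensorProduct.induction_on with
      | zero => simp
      | add y y' hy hy' => simp only [map_add, hy, hy']
      | tmul u' v' =>
        simp only [tensorForm, TensorProduct.congr_tmul, LinearEquiv.refl_apply,
          LinearMap.BilinForm.tensorDistrib_tmul, sympV_toLin']⟩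
  map_one' := by
    apply Subtype.ext
    apply LinearEquiv.toLinearMap_injective
    ext u i
    simp
  map_mul' g h := by
    apply Subtype.ext
    apply LinearEquiv.toLinearMap_injective
    ext u i
    simp

variable {E : Type*} [AddCommGroup E] [Module ℂ E]

/-- The restriction to `G = SL₂(F)` of a representation of `Sp(U ⊗ V)`. -/
def resSL {β : LinearMap.BilinForm F U} (ω : Representation ℂ (SpGroup (tensorForm β)) E) :
    Representation ℂ (Matrix.SpecialLinearGroup (Fin 2) F) E :=
  ω.comp (slToSp β)

end DualPair

end

open scoped TensorProduct

/-! A diagonalization `β = ⟨a₁⟩ ⊕ ⟨a₂⟩` makes `U ⊗ V` an orthogonal sum of two copies of `F ⊗ V`.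
The tensor product of the Heisenberg representations of the summands is irreducible with central
character `ψ` (`heisenbergTensor_isHeisenbergRep`), so by Stone-von Neumann
(`IsHeisenbergRep.exists_equiv`) it is the Heisenberg representation of `U ⊗ V`. On this one space
both `ω` and `ω₁ ⊗ ω₂` implement the action of `G` on the Heisenberg group, so by Schur they differ
by a character `χ` of `G` (`exists_character`).

If `q > 3`, then `G` is perfect and `χ = 1`. If `q = 3`, it suffices to treat transvections `u`,
which generate `G`. Let `e` be the basis vector fixed by `u`. The Lagrangian `U ⊗ e` fixes a single
line, spanned by `v₁ ⊗ v₂`. The canonical choice of `ω₁` and `ω₂` gives `ω₁(u)v₁ = v₁` and `ω₂(u)v₂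
= v₂`. On the other side, `u³ = 1`, and `u` is inverted by an element of `Sp(U ⊗ V)` which preserves
`U ⊗ e`, so `ω(u)` acts on the line by a scalar `a` with `a³ = a² = 1`.

It remains to diagonalize the two planes: `-1` is a square when `q ≡ 1 mod 4`, and `ε` times a
square when `q ≡ 3 mod 4`. -/

noncomputable section

/-! ### Irreducible representations and the Stone-von Neumann theorem. -/

section HeisenbergTheory

namespace Representation

variable {k G E : Type*} [Field k] [Monoid G] [AddCommGroup E] [Module k E]

/-- A nonzero stable submodule of an irreducible representation is everything. -/
lemma IsIrreducible.eq_top_of_stable {ρ : Representation k G E} (h : ρ.IsIrreducible)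
    (N : Submodule k E) (hN : ∀ g, ∀ v ∈ N, ρ g v ∈ N) {v : E} (hv : v ∈ N) (hv0 : v ≠ 0) :
    N = ⊤ := by
  have := h
  rcases eq_bot_or_eq_top (⟨N, fun g v hv => hN g v hv⟩ : Subrepresentation ρ) with h0 | h1
  · have h2 : N = ⊥ := congrArg Subrepresentation.toSubmodule h0
    exact absurd ((Submodule.mem_bot k).1 (h2 ▸ hv)) hv0
  · exact congrArg Subrepresentation.toSubmodule h1

lemma IsIrreducible.nontrivial {ρ : Representation k G E} (h : ρ.IsIrreducible) :
    Nontrivial E := by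
  by_contra hE
  rw [not_nontrivial_iff_subsingleton] at hE
  have := h
  have h01 : (⊥ : Subrepresentation ρ) ≠ ⊤ := bot_ne_top
  apply h01
  apply Subrepresentation.toSubmodule_injective
  exact Subsingleton.elim _ _

lemma IsIrreducible.of_stable [Nontrivial E] {ρ : Representation k G E}
    (h : ∀ N : Submodule k E, (∀ g, ∀ v ∈ N, ρ g v ∈ N) → ∀ v ∈ N, v ≠ 0 → N = ⊤) :
    ρ.IsIrreducible := by
  have h01 : (⊥ : Subrepresentation ρ) ≠ ⊤ := by
    intro h
    have h2 : (⊥ : Submodule k E) = ⊤ := congrArg Subrepresentation.toSubmodule h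
    exact bot_ne_top h2
  refine { exists_pair_ne := ⟨_, _, h01⟩, eq_bot_or_eq_top := fun N => ?_ }
  by_cases hN : N.toSubmodule = ⊥
  · exact Or.inl (Subrepresentation.toSubmodule_injective hN)
  · obtain ⟨v, hv, hv0⟩ := Submodule.exists_mem_ne_zero_of_ne_bot hN
    exact Or.inr (Subrepresentation.toSubmodule_injective
      (h _ (fun g v hv => N.apply_mem_toSubmodule g hv) v hv hv0))

/-- An irreducible representation is spanned by the orbit of any nonzero vector. -/
lemma IsIrreducible.span_orbit {ρ : Representation k G E} (h : ρ.IsIrreducible)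
    {v : E} (hv : v ≠ 0) : Submodule.span k (Set.range fun g => ρ g v) = ⊤ := by
  refine h.eq_top_of_stable _ (fun g x hx => ?_)
    (v := v) (Submodule.subset_span ⟨1, by simp⟩) hv
  induction hx using Submodule.span_induction with
  | mem x hx =>
    obtain ⟨g', rfl⟩ := hx
    exact Submodule.subset_span ⟨g * g', by simp⟩
  | zero => simp
  | add x y _ _ hx hy => rw [map_add]; exact add_mem hx hy
  | smul c x _ hx => rw [map_smul]; exact Submodule.smul_mem _ _ hx

lemma IsIrreducible.finiteDimensional [Finite G] {ρ : Representation k G E}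
    (h : ρ.IsIrreducible) : FiniteDimensional k E := by
  have := h.nontrivial
  obtain ⟨v, hv⟩ := exists_ne (0 : E)
  exact ⟨by rw [← h.span_orbit hv]; exact Submodule.fg_span (Set.finite_range _)⟩

/-- Schur's lemma, for endomorphisms of an irreducible representation of a finite group. -/
lemma IsIrreducible.exists_scalar [Finite G] [IsAlgClosed k] {ρ : Representation k G E}
    (h : ρ.IsIrreducible) (A : E →ₗ[k] E) (hA : ∀ g v, A (ρ g v) = ρ g (A v)) :
    ∃ c : k, ∀ v, A v = c • v := by
  have := h
  have := h.finiteDimensional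
  let f : IntertwiningMap ρ ρ := A.intertwiningMap_of_isIntertwiningMap _ _ hA
  obtain ⟨c, hc⟩ := (IsIrreducible.algebraMap_intertwiningMap_bijective_of_isAlgClosed (ρ := ρ)).2 f
  refine ⟨c, fun v => ?_⟩
  have := DFunLike.congr_fun hc v
  simpa [f] using this.symm

end Representation

variable {F W : Type*} [Field F] [AddCommGroup W] [Module F W] {B : LinearMap.BilinForm F W}

instance Heisenberg.instFinite [Finite F] [Finite W] : Finite (Heisenberg B) :=
  Finite.of_injective (fun h => (h.vec, h.cen)) fun h k e => by
    simp only [Prod.mk.injEq] at e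
    exact Heisenberg.ext e.1 e.2

lemma Heisenberg.eq_central_mul (h : Heisenberg B) :
    h = (⟨0, h.cen⟩ : Heisenberg B) * ⟨h.vec, 0⟩ := by
  ext <;> simp

variable {E : Type*} [AddCommGroup E] [Module ℂ E] {ψ : AddChar F ℂ}
  {π : Representation ℂ (Heisenberg B) E}

/-- `π` has central character `ψ`. -/
def HasCentralChar (ψ : AddChar F ℂ) (π : Representation ℂ (Heisenberg B) E) : Prop :=
  ∀ (z : F) (v : E), π ⟨0, z⟩ v = ψ z • v

namespace HasCentralChar

variable (hc : HasCentralChar ψ π)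
include hc

lemma apply (h : Heisenberg B) (v : E) : π h v = ψ h.cen • π ⟨h.vec, 0⟩ v := by
  conv_lhs => rw [h.eq_central_mul, map_mul, Module.End.mul_apply, hc]

lemma vec_mul (a b : W) (v : E) :
    π ⟨a, 0⟩ (π ⟨b, 0⟩ v) = ψ (2⁻¹ * B a b) • π ⟨a + b, 0⟩ v := by
  rw [← Module.End.mul_apply, ← map_mul, hc.apply]
  simp

lemma neg_vec (hB : B.IsAlt) (a : W) (v : E) : π ⟨-a, 0⟩ (π ⟨a, 0⟩ v) = v := by
  rw [hc.vec_mul]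
  simp only [map_neg, LinearMap.neg_apply, hB.self_eq_zero, neg_zero, mul_zero,
    AddChar.map_zero_eq_one, one_smul, neg_add_cancel]
  simpa using hc 0 v

/-- The two cocycle factors `½ B a b` and `½ B b a` differ by `B a b`, since `B` is antisymmetric.
This commutation rule is the source of all character sums below. -/
lemma vec_comm (hB : B.IsAlt) (h2 : (2 : F) ≠ 0) (a b : W) (v : E) :
    π ⟨a, 0⟩ (π ⟨b, 0⟩ v) = ψ (B a b) • π ⟨b, 0⟩ (π ⟨a, 0⟩ v) := by
  rw [hc.vec_mul, hc.vec_mul, smul_smul, ← AddChar.map_add_eq_mul, add_comm b a]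
  congr 2
  rw [← hB.neg_eq a b]
  field_simp
  ring

end HasCentralChar

/-- The character of a vector space attached to a nonzero functional is nontrivial. -/
lemma sum_char_functional_eq_zero {V : Type*} [AddCommGroup V] [Module F V] [Fintype V]
    (hψ : ψ ≠ 1) {l : V →ₗ[F] F} (hl : ∃ w, l w ≠ 0) : ∑ w, ψ (l w) = 0 := by
  refine AddChar.sum_eq_zero_of_ne_one (ψ := ψ.compAddMonoidHom l.toAddMonoidHom) fun h => hψ ?_
  obtain ⟨w, hw⟩ := hl
  ext z
  have := DFunLike.congr_fun h ((z / l w) • w)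
  simpa [div_mul_cancel₀ _ hw] using this

/-- The operators `π (w, 0)` are linearly independent. -/
lemma HasCentralChar.linearIndependent [Fintype W] [Nontrivial E] (hc : HasCentralChar ψ π)
    (hB : B.IsAlt) (h2 : (2 : F) ≠ 0) (hψ : ψ ≠ 1) (hnd : ∀ u, u ≠ 0 → ∃ w, B w u ≠ 0)
    (f : W → ℂ) (hf : ∀ v, ∑ w, f w • π ⟨w, 0⟩ v = 0) : f = 0 := by
  classical
  ext u
  obtain ⟨v, hv⟩ := exists_ne (0 : E)
  -- Conjugating the relation by `π (w', 0)` multiplies its `w`-th term by `ψ (B w' w)`. The extra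
  -- factor `ψ (-B w' u)` prepares for orthogonality of characters: summing over `w'` leaves only
  -- the term `w = u`.
  have key : ∀ w', ∑ w, (f w * ψ (B w' (w - u))) • π ⟨w, 0⟩ v = 0 := by
    intro w'
    have h1 := hf (π ⟨-w', 0⟩ v)
    have h3 := congrArg (fun x => ψ (-B w' u) • π ⟨w', 0⟩ x) h1
    simp only [map_sum, map_smul, map_zero, smul_zero, Finset.smul_sum] at h3
    rw [← h3]
    refine Finset.sum_congr rfl fun w _ => ?_
    have h4 : π ⟨w', 0⟩ (π ⟨-w', 0⟩ v) = v := by simpa using hc.neg_vec hB (-w') v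
    rw [hc.vec_comm hB h2 w' w, h4]
    have h7 : B w' (w - u) = -B w' u + B w' w := by rw [map_sub]; ring
    rw [h7, AddChar.map_add_eq_mul, smul_smul, smul_smul]
    congr 1
    ring
  have h5 : ∑ w', ∑ w, (f w * ψ (B w' (w - u))) • π ⟨w, 0⟩ v = 0 :=
    Finset.sum_eq_zero fun w' _ => key w'
  rw [Finset.sum_comm] at h5
  simp only [← Finset.sum_smul, ← Finset.mul_sum] at h5
  rw [Finset.sum_eq_single u] at h5
  · simp only [sub_self, map_zero, AddChar.map_zero_eq_one, Finset.sum_const, Finset.card_univ,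
      nsmul_eq_mul, mul_one] at h5
    rcases smul_eq_zero.1 h5 with h6 | h6
    · simpa using h6
    · refine absurd ?_ hv
      rw [← hc.neg_vec hB u v, h6, map_zero]
  · intro w _ hw
    have h6 : ∑ x, ψ (B x (w - u)) = 0 :=
      sum_char_functional_eq_zero hψ (l := LinearMap.flip B (w - u)) (hnd _ (sub_ne_zero.2 hw))
    rw [h6, mul_zero, zero_smul]
  · simp

variable {E' : Type*} [AddCommGroup E'] [Module ℂ E'] {π' : Representation ℂ (Heisenberg B) E'}

/-- The average over `W` of the operator `ξ ⊗ v` of rank one. -/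
def heisenbergAverage [Fintype W] (π' : Representation ℂ (Heisenberg B) E')
    (π : Representation ℂ (Heisenberg B) E) (ξ : E' →ₗ[ℂ] ℂ) (v : E) : E' →ₗ[ℂ] E :=
  ∑ w : W, LinearMap.smulRight (ξ ∘ₗ π' ⟨-w, 0⟩) (π ⟨w, 0⟩ v)

lemma heisenbergAverage_apply [Fintype W] (ξ : E' →ₗ[ℂ] ℂ) (v : E) (x : E') :
    heisenbergAverage π' π ξ v x = ∑ w, ξ (π' ⟨-w, 0⟩ x) • π ⟨w, 0⟩ v := by
  simp [heisenbergAverage, LinearMap.sum_apply]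

/-- Substituting `h.vec + w` for `w` moves the translation from one side to the other, and the
cocycles match because `B (-(h.vec + w)) h.vec = B h.vec w`. Averaging over `W` is enough, since the
centre acts on both sides by `ψ`. -/
lemma heisenbergAverage_intertwines [Fintype W] (hc : HasCentralChar ψ π)
    (hc' : HasCentralChar ψ π') (hB : B.IsAlt)
    (ξ : E' →ₗ[ℂ] ℂ) (v : E) (h : Heisenberg B) (x : E') :
    heisenbergAverage π' π ξ v (π' h x) = π h (heisenbergAverage π' π ξ v x) := by
  rw [hc'.apply, hc.apply, map_smul]
  congr 1
  simp only [heisenbergAverage_apply, map_sum, map_smul]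
  rw [← Equiv.sum_comp (Equiv.addLeft h.vec)]
  refine Finset.sum_congr rfl fun w _ => ?_
  simp only [Equiv.coe_addLeft]
  rw [hc'.vec_mul, hc.vec_mul, map_smul, smul_smul, smul_eq_mul, mul_comm]
  have h1 : B (-(h.vec + w)) h.vec = B h.vec w := by
    rw [map_neg, map_add, LinearMap.neg_apply, LinearMap.add_apply, hB.self_eq_zero,
      ← hB.neg_eq h.vec w]
    ring
  rw [h1, show -(h.vec + w) + h.vec = -w by abel]

/-- For fixed `ξ` and `x`, vanishing of all averages would be a linear relation between the
operators `π (w, 0)` with coefficient `ξ x` at `w = 0`. -/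
lemma exists_heisenbergAverage_ne_zero [Fintype W] [Nontrivial E] [Nontrivial E']
    (hc : HasCentralChar ψ π) (hc' : HasCentralChar ψ π')
    (hB : B.IsAlt) (h2 : (2 : F) ≠ 0) (hψ : ψ ≠ 1) (hnd : ∀ u, u ≠ 0 → ∃ w, B w u ≠ 0) :
    ∃ ξ v, heisenbergAverage π' π ξ v ≠ 0 := by
  obtain ⟨x, hx⟩ := exists_ne (0 : E')
  obtain ⟨ξ, hξ⟩ : ∃ ξ : E' →ₗ[ℂ] ℂ, ξ x ≠ 0 := by
    by_contra! h
    exact hx ((Module.forall_dual_apply_eq_zero_iff ℂ x).1 h)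
  by_contra! h
  have h0 := hc.linearIndependent hB h2 hψ hnd (fun w => ξ (π' ⟨-w, 0⟩ x)) fun v => by
    rw [← heisenbergAverage_apply, h, LinearMap.zero_apply]
  have h1 := congrFun h0 0
  simp only [neg_zero, Pi.zero_apply] at h1
  rw [hc'] at h1
  simp [hξ] at h1

/-- Stone-von Neumann: Heisenberg representations with the same central character are
isomorphic. -/
theorem IsHeisenbergRep.exists_equiv [Finite W]
    (hπ : IsHeisenbergRep ψ π) (hπ' : IsHeisenbergRep ψ π')
    (hB : B.IsAlt) (h2 : (2 : F) ≠ 0) (hψ : ψ ≠ 1) (hnd : ∀ u, u ≠ 0 → ∃ w, B w u ≠ 0) :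
    Nonempty (π'.Equiv π) := by
  cases nonempty_fintype W
  have := hπ.irreducible
  have := hπ'.irreducible
  have := hπ.irreducible.nontrivial
  have := hπ'.irreducible.nontrivial
  obtain ⟨ξ, v, hf⟩ := exists_heisenbergAverage_ne_zero hπ.central hπ'.central hB h2 hψ hnd
  let f : π'.IntertwiningMap π := (heisenbergAverage π' π ξ v).intertwiningMap_of_isIntertwiningMap
    _ _ (heisenbergAverage_intertwines hπ.central hπ'.central hB ξ v)
  rcases Representation.IsIrreducible.bijective_or_eq_zero f with h | h
  · exact ⟨f.ofBijective h⟩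
  · exact absurd (congrArg Representation.IntertwiningMap.toLinearMap h) hf

end HeisenbergTheory

/-! ### Heisenberg representations of orthogonal sums. -/

section OrthogonalSum

variable {F W W₁ W₂ : Type*} [Field F] [AddCommGroup W] [Module F W]
  [AddCommGroup W₁] [Module F W₁] [AddCommGroup W₂] [Module F W₂]
  {B : LinearMap.BilinForm F W} {B₁ : LinearMap.BilinForm F W₁} {B₂ : LinearMap.BilinForm F W₂}
  {E₁ E₂ : Type*} [AddCommGroup E₁] [Module ℂ E₁] [AddCommGroup E₂] [Module ℂ E₂]
  {ψ : AddChar F ℂ}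

/-- The representation of the Heisenberg group of an orthogonal sum on the tensor product of
representations of the Heisenberg groups of the summands. -/
def heisenbergTensor (p₁ : W →ₗ[F] W₁) (p₂ : W →ₗ[F] W₂)
    (hp : ∀ a b, B a b = B₁ (p₁ a) (p₁ b) + B₂ (p₂ a) (p₂ b))
    {π₁ : Representation ℂ (Heisenberg B₁) E₁} {π₂ : Representation ℂ (Heisenberg B₂) E₂}
    (hc₁ : HasCentralChar ψ π₁) (hc₂ : HasCentralChar ψ π₂) :
    Representation ℂ (Heisenberg B) (E₁ ⊗[ℂ] E₂) where
  toFun h := ψ h.cen • TensorProduct.map (π₁ ⟨p₁ h.vec, 0⟩) (π₂ ⟨p₂ h.vec, 0⟩)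
  map_one' := by
    have h1 : (⟨0, 0⟩ : Heisenberg B₁) = 1 := rfl
    have h2 : (⟨0, 0⟩ : Heisenberg B₂) = 1 := rfl
    simp [h1, h2]
  map_mul' h k := by
    ext x y
    simp only [TensorProduct.AlgebraTensorModule.curry_apply, LinearMap.restrictScalars_self,
      TensorProduct.curry_apply, LinearMap.smul_apply, TensorProduct.map_tmul,
      Module.End.mul_apply, map_smul, hc₁.vec_mul, hc₂.vec_mul, TensorProduct.smul_tmul',
      TensorProduct.tmul_smul, smul_smul, Heisenberg.mul_vec, Heisenberg.mul_cen, map_add, hp,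
      mul_add, AddChar.map_add_eq_mul]
    congr 1
    ac_rfl

variable {p₁ : W →ₗ[F] W₁} {p₂ : W →ₗ[F] W₂}
  {hp : ∀ a b, B a b = B₁ (p₁ a) (p₁ b) + B₂ (p₂ a) (p₂ b)}
  {π₁ : Representation ℂ (Heisenberg B₁) E₁} {π₂ : Representation ℂ (Heisenberg B₂) E₂}

lemma heisenbergTensor_vec (hc₁ : HasCentralChar ψ π₁) (hc₂ : HasCentralChar ψ π₂) (w : W) :
    heisenbergTensor p₁ p₂ hp hc₁ hc₂ ⟨w, 0⟩ =
      TensorProduct.map (π₁ ⟨p₁ w, 0⟩) (π₂ ⟨p₂ w, 0⟩) := by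
  simp [heisenbergTensor]

lemma heisenbergTensor_hasCentralChar (hc₁ : HasCentralChar ψ π₁) (hc₂ : HasCentralChar ψ π₂) :
    HasCentralChar ψ (heisenbergTensor p₁ p₂ hp hc₁ hc₂) := by
  intro z v
  have h1 : (⟨0, 0⟩ : Heisenberg B₁) = 1 := rfl
  have h2 : (⟨0, 0⟩ : Heisenberg B₂) = 1 := rfl
  simp [heisenbergTensor, h1, h2]

/-- A submodule stable under the operators `π (w, 0)` is stable under `π`. -/
lemma HasCentralChar.eq_top_of_stable {E : Type*} [AddCommGroup E] [Module ℂ E]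
    {π : Representation ℂ (Heisenberg B) E} (hc : HasCentralChar ψ π) (hi : π.IsIrreducible)
    (N : Submodule ℂ E) (hN : ∀ w, ∀ v ∈ N, π ⟨w, 0⟩ v ∈ N) {v : E} (hv : v ∈ N) (hv0 : v ≠ 0) :
    N = ⊤ :=
  hi.eq_top_of_stable N (fun g x hx => by
    rw [hc.apply]; exact N.smul_mem _ (hN _ x hx)) hv hv0

/-- The span of the operators `π (w, 0)` contains a nonzero multiple `v ↦ c v • u` of every
operator of rank one with a common functional `c`. -/
lemma IsHeisenbergRep.exists_functional [Finite F] [Fintype W] {E : Type*} [AddCommGroup E]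
    [Module ℂ E] {π : Representation ℂ (Heisenberg B) E} (hπ : IsHeisenbergRep ψ π)
    (hB : B.IsAlt) (h2 : (2 : F) ≠ 0) (hψ : ψ ≠ 1) (hnd : ∀ u, u ≠ 0 → ∃ w, B w u ≠ 0) :
    ∃ c : E →ₗ[ℂ] ℂ, c ≠ 0 ∧ ∀ u, ∃ f : W → ℂ, ∀ v, ∑ w, f w • π ⟨w, 0⟩ v = c v • u := by
  have := hπ.irreducible.nontrivial
  obtain ⟨ξ, v₀, h0⟩ := exists_heisenbergAverage_ne_zero (π := π) (π' := π)
    hπ.central hπ.central hB h2 hψ hnd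
  -- The average commutes with `π`, so it is a scalar `c v` by Schur. Read with `u` fixed and `v`
  -- varying, the same sum is the operator `v ↦ c v • u`.
  have hs : ∀ v, ∃ c : ℂ, ∀ u, heisenbergAverage π π ξ v u = c • u := fun v =>
    hπ.irreducible.exists_scalar _
      (heisenbergAverage_intertwines hπ.central hπ.central hB ξ v)
  choose c hc using hs
  obtain ⟨u₀, hu₀⟩ := exists_ne (0 : E)
  refine ⟨{ toFun := c, map_add' := fun v v' => ?_, map_smul' := fun a v => ?_ }, ?_,
    fun u => ⟨fun w => ξ (π ⟨-w, 0⟩ u), fun v => ?_⟩⟩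
  · apply smul_left_injective ℂ hu₀
    simp only [add_smul, ← hc, heisenbergAverage_apply, map_add, smul_add, Finset.sum_add_distrib]
  · apply smul_left_injective ℂ hu₀
    simp only [RingHom.id_apply, smul_assoc, ← hc, heisenbergAverage_apply, map_smul,
      Finset.smul_sum]
    exact Finset.sum_congr rfl fun w _ => smul_comm _ _ _
  · intro h
    apply h0
    ext u
    rw [hc, show c v₀ = 0 from DFunLike.congr_fun h v₀]
    simp
  · rw [← heisenbergAverage_apply, hc]
    rfl

/-- Contraction with the coordinate functionals of a basis of `E₂` gives the coordinates of `t` in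
`E₁`, and these are not all zero. -/
lemma exists_rid_lTensor_ne_zero {t : E₁ ⊗[ℂ] E₂} (ht : t ≠ 0) :
    ∃ η : E₂ →ₗ[ℂ] ℂ, TensorProduct.rid ℂ E₁ (η.lTensor E₁ t) ≠ 0 := by
  classical
  by_contra! h
  apply ht
  let b := Module.Basis.ofVectorSpace ℂ E₂
  apply (TensorProduct.equivFinsuppOfBasisRight (M := E₁) b).injective
  rw [map_zero]
  ext i
  rw [Finsupp.zero_apply, ← h (b.coord i)]
  clear * -
  induction t using TensorProduct.induction_on with
  | zero => simp
  | add x y hx hy => simp only [map_add, Finsupp.add_apply, hx, hy]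
  | tmul x y => simp

/-- The tensor product of Heisenberg representations is a Heisenberg representation. -/
theorem heisenbergTensor_isHeisenbergRep [Finite F] [Finite W₁]
    (hsurj : ∀ a b, ∃ w, p₁ w = a ∧ p₂ w = b)
    (hπ₁ : IsHeisenbergRep ψ π₁) (hπ₂ : IsHeisenbergRep ψ π₂)
    (hB₁ : B₁.IsAlt) (h2 : (2 : F) ≠ 0) (hψ : ψ ≠ 1) (hnd₁ : ∀ u, u ≠ 0 → ∃ w, B₁ w u ≠ 0) :
    IsHeisenbergRep ψ (heisenbergTensor p₁ p₂ hp hπ₁.central hπ₂.central) := by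
  cases nonempty_fintype W₁
  have := hπ₁.irreducible.nontrivial
  have := hπ₂.irreducible.nontrivial
  refine ⟨.of_stable fun N hN t ht ht0 => ?_,
    heisenbergTensor_hasCentralChar hπ₁.central hπ₂.central⟩
  -- Surjectivity of `(p₁, p₂)` lets the two tensor factors be translated independently.
  have hN' : ∀ a b, ∀ x ∈ N, TensorProduct.map (π₁ ⟨a, 0⟩) (π₂ ⟨b, 0⟩) x ∈ N := by
    intro a b x hx
    obtain ⟨w, rfl, rfl⟩ := hsurj a b
    rw [← heisenbergTensor_vec (hp := hp) hπ₁.central hπ₂.central]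
    exact hN _ x hx
  have hN₁ : ∀ a, ∀ x ∈ N, (π₁ ⟨a, 0⟩).rTensor E₂ x ∈ N := fun a x hx => by
    have := hN' a 0 x hx
    rwa [show (⟨0, 0⟩ : Heisenberg B₂) = 1 from rfl, map_one] at this
  have hN₂ : ∀ b, ∀ x ∈ N, (π₂ ⟨b, 0⟩).lTensor E₁ x ∈ N := fun b x hx => by
    have := hN' 0 b x hx
    rwa [show (⟨0, 0⟩ : Heisenberg B₁) = 1 from rfl, map_one] at this
  obtain ⟨c, hc0, hc⟩ := hπ₁.exists_functional hB₁ h2 hψ hnd₁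
  obtain ⟨η, hη⟩ := exists_rid_lTensor_ne_zero ht0
  set y := TensorProduct.rid ℂ E₁ (η.lTensor E₁ t) with hy
  -- some translate of `t` is not killed by `c ⊗ 1`
  obtain ⟨a, ha⟩ : ∃ a, c (π₁ ⟨a, 0⟩ y) ≠ 0 := by
    by_contra! h
    -- The vectors whose translates are all killed by `c` form a stable subspace. It would contain
    -- `y ≠ 0`, hence be everything, against `c ≠ 0`.
    let K : Submodule ℂ E₁ := ⨅ a, LinearMap.ker (c ∘ₗ π₁ ⟨a, 0⟩)
    have hK : ∀ x, x ∈ K ↔ ∀ a, c (π₁ ⟨a, 0⟩ x) = 0 := fun x => by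
      simp [K, Submodule.mem_iInf]
    have hKt : K = ⊤ := HasCentralChar.eq_top_of_stable hπ₁.central hπ₁.irreducible K (fun w x hx => by
      rw [hK] at hx ⊢
      intro a
      rw [HasCentralChar.vec_mul hπ₁.central, map_smul, hx, smul_zero]) ((hK y).2 h) hη
    apply hc0
    ext x
    have hx : x ∈ K := hKt ▸ Submodule.mem_top
    have := (hK x).1 hx 0
    rwa [show (⟨0, 0⟩ : Heisenberg B₁) = 1 from rfl, map_one] at this
  set t' := (π₁ ⟨a, 0⟩).rTensor E₂ t with ht'
  set b := TensorProduct.lid ℂ E₂ (c.rTensor E₂ t') with hb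
  -- Contracting `b` with `η` gives `c (π₁ (a, 0) y)`, as the two contractions act on different
  -- factors.
  have hb0 : b ≠ 0 := by
    intro h0
    apply ha
    rw [← map_zero η, ← h0, hb, ht', hy]
    clear_value t' y
    clear * -
    induction t using TensorProduct.induction_on with
    | zero => simp
    | add x y hx hy => simp only [map_add, hx, hy]
    | tmul x y => simp [mul_comm]
  -- The operator `x ↦ c x • u` on the first factor is a combination of the `π₁ (w, 0)` and sends
  -- `t'` to `u ⊗ b`. Irreducibility of `π₂` then replaces `b` by any vector.
  have hmem : ∀ u, u ⊗ₜ[ℂ] b ∈ N := by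
    intro u
    obtain ⟨f, hf⟩ := hc u
    have h1 : ∑ w, f w • (π₁ ⟨w, 0⟩).rTensor E₂ t' ∈ N :=
      Submodule.sum_mem _ fun w _ => N.smul_mem _ (hN₁ w _ (hN₁ a t ht))
    convert h1 using 1
    rw [hb]
    clear_value t'
    clear * - hf
    induction t' using TensorProduct.induction_on with
    | zero => simp
    | add x y hx hy => simp only [map_add, TensorProduct.tmul_add, smul_add,
        Finset.sum_add_distrib, hx, hy]
    | tmul x y =>
      simp only [LinearMap.rTensor_tmul, TensorProduct.lid_tmul, TensorProduct.smul_tmul',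
        ← TensorProduct.sum_tmul, hf, TensorProduct.tmul_smul]
  have hall : ∀ u v, u ⊗ₜ[ℂ] v ∈ N := by
    intro u v
    have hKt := HasCentralChar.eq_top_of_stable hπ₂.central hπ₂.irreducible
      (N.comap (TensorProduct.mk ℂ E₁ E₂ u)) (fun w x hx => by
        simpa using hN₂ w _ hx) (v := b) (hmem u) hb0
    have : v ∈ N.comap (TensorProduct.mk ℂ E₁ E₂ u) := hKt ▸ Submodule.mem_top
    exact this
  rw [eq_top_iff, ← TensorProduct.span_tmul_eq_top, Submodule.span_le]
  rintro _ ⟨u, v, rfl⟩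
  exact hall u v

end OrthogonalSum

/-! ### Oscillator representations, vectors fixed by a Lagrangian, and the comparison character. -/

section Oscillator

variable {F W W₁ W₂ : Type*} [Field F] [AddCommGroup W] [Module F W]
  [AddCommGroup W₁] [Module F W₁] [AddCommGroup W₂] [Module F W₂]
  {B : LinearMap.BilinForm F W} {B₁ : LinearMap.BilinForm F W₁} {B₂ : LinearMap.BilinForm F W₂}
  {E E₁ E₂ : Type*} [AddCommGroup E] [Module ℂ E]
  [AddCommGroup E₁] [Module ℂ E₁] [AddCommGroup E₂] [Module ℂ E₂]
  {ψ : AddChar F ℂ}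

/-- `ω` implements the action of `Sp(W)` on the Heisenberg group in the representation `π`. -/
def Implements (π : Representation ℂ (Heisenberg B) E) (ω : Representation ℂ (SpGroup B) E) :
    Prop :=
  ∀ (g : SpGroup B) (h : Heisenberg B) (v : E), ω g (π h v) = π (Heisenberg.act g h) (ω g v)

lemma implements_of_conj {π : Representation ℂ (Heisenberg B) E}
    {ω : Representation ℂ (SpGroup B) E}
    (h : ∀ (g : SpGroup B) (h : Heisenberg B), ω g ∘ₗ π h ∘ₗ ω g⁻¹ = π (Heisenberg.act g h)) :
    Implements π ω := by
  intro g k v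
  rw [← h]
  simp

section Fixed

variable {π : Representation ℂ (Heisenberg B) E} {ω : Representation ℂ (SpGroup B) E}

/-- `v` is fixed by the operators `π (w, 0)` for `w` in `L`. -/
def FixedBy (π : Representation ℂ (Heisenberg B) E) (L : Submodule F W) (v : E) : Prop :=
  ∀ w ∈ L, π ⟨w, 0⟩ v = v

/-- A subspace has nonzero fixed vectors. -/
lemma exists_fixedBy_ne_zero [Finite W] (hπ : IsHeisenbergRep ψ π) (hB : B.IsAlt)
    (h2 : (2 : F) ≠ 0) (hψ : ψ ≠ 1) (hnd : ∀ u, u ≠ 0 → ∃ w, B w u ≠ 0) (L : Submodule F W)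
    (hL : ∀ a ∈ L, ∀ b ∈ L, B a b = 0) : ∃ v, v ≠ 0 ∧ FixedBy π L v := by
  classical
  cases nonempty_fintype W
  have := hπ.irreducible.nontrivial
  have hc : HasCentralChar ψ π := hπ.central
  -- The sum of `π (l, 0)` over `L` is a nonzero operator by linear independence. Its values are
  -- fixed by `L`, because the cocycle vanishes on the isotropic subspace `L`.
  obtain ⟨v, hv⟩ : ∃ v, ∑ w, (if w ∈ L then (1 : ℂ) else 0) • π ⟨w, 0⟩ v ≠ 0 := by
    by_contra! h
    have := congrFun (hc.linearIndependent hB h2 hψ hnd _ h) 0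
    simp at this
  refine ⟨_, hv, fun a ha => ?_⟩
  rw [map_sum]
  refine (Finset.sum_congr rfl fun w _ => ?_).trans (Equiv.sum_comp (Equiv.addLeft a) _)
  have hw : a + w ∈ L ↔ w ∈ L := L.add_mem_iff_right ha
  simp only [Equiv.coe_addLeft, hw]
  split_ifs with h
  · rw [one_smul, one_smul, hc.vec_mul, hL a ha w h]
    simp
  · simp

/-- The vectors fixed by a Lagrangian subspace form a line. -/
lemma FixedBy.exists_eq_smul [Finite W] (hπ : IsHeisenbergRep ψ π) (hB : B.IsAlt)
    (h2 : (2 : F) ≠ 0) (hψ : ψ ≠ 1) {L : Submodule F W}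
    (hL : ∀ w, (∀ l ∈ L, B l w = 0) → w ∈ L) {v x : E} (hv : FixedBy π L v) (hv0 : v ≠ 0)
    (hx : FixedBy π L x) : ∃ c : ℂ, x = c • v := by
  classical
  cases nonempty_fintype W
  have hc : HasCentralChar ψ π := hπ.central
  -- `P` multiplies fixed vectors by the order of `L`. The translates of `v` span `E`, and `P` sends
  -- each of them into the line of `v`.
  let P : E →ₗ[ℂ] E := ∑ l : L, π ⟨l, 0⟩
  have hP : ∀ y, P y = ∑ l : L, π ⟨l, 0⟩ y := fun y => by simp [P, LinearMap.sum_apply]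
  have hPx : P x = (Fintype.card L : ℂ) • x := by
    have hPx' : ∀ l : L, π ⟨l, 0⟩ x = x := fun l => hx l l.2
    simp only [hP, hPx']
    simp [Nat.cast_smul_eq_nsmul]
  have hPv : ∀ l : L, π ⟨l, 0⟩ v = v := fun l => hv l l.2
  have hmem : P x ∈ Submodule.span ℂ {v} := by
    have hx' : x ∈ Submodule.span ℂ (Set.range fun g => π g v) :=
      hπ.irreducible.span_orbit hv0 ▸ Submodule.mem_top
    clear hx hPx
    induction hx' using Submodule.span_induction with
    | zero => simp
    | add x y _ _ hx hy => rw [map_add]; exact add_mem hx hy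
    | smul c x _ hx => rw [map_smul]; exact Submodule.smul_mem _ _ hx
    | mem x hx =>
      obtain ⟨h, rfl⟩ := hx
      simp only
      rw [hc.apply, map_smul]
      refine Submodule.smul_mem _ _ ?_
      by_cases hw : h.vec ∈ L
      · simp only [hv _ hw, hP, hPv]
        exact Submodule.sum_mem _ fun _ _ => Submodule.mem_span_singleton_self v
      -- Outside `L` the translate of `v` is an eigenvector of `L` for the character `l ↦ ψ (B l
      -- h.vec)`, which is nontrivial because `L` contains its orthogonal; so `P` kills it.
      · obtain ⟨l, hl, hlw⟩ : ∃ l ∈ L, B l h.vec ≠ 0 := by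
          by_contra! h'
          exact hw (hL _ h')
        have h0 : ∑ l : L, ψ (B l h.vec) = 0 :=
          sum_char_functional_eq_zero hψ (l := (LinearMap.flip B h.vec) ∘ₗ L.subtype)
            ⟨⟨l, hl⟩, hlw⟩
        have h1 : P (π ⟨h.vec, 0⟩ v) = 0 := by
          rw [hP]
          simp only [hc.vec_comm hB h2 _ h.vec, hPv]
          rw [← Finset.sum_smul, h0, zero_smul]
        rw [h1]
        exact zero_mem _
  obtain ⟨c, hc'⟩ := Submodule.mem_span_singleton.1 hmem
  have hcard : (Fintype.card L : ℂ) ≠ 0 := Nat.cast_ne_zero.2 Fintype.card_ne_zero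
  refine ⟨(Fintype.card L : ℂ)⁻¹ * c, ?_⟩
  rw [mul_smul, hc', hPx, smul_smul, inv_mul_cancel₀ hcard, one_smul]

/-- `ω g` carries vectors fixed by `L` to vectors fixed by `gL`, and `hg` says that `L ⊆ gL`. -/
lemma FixedBy.map (hω : Implements π ω) {L : Submodule F W} {v : E} (hv : FixedBy π L v)
    {g : SpGroup B} (hg : ∀ l ∈ L, ∃ l' ∈ L, (g : W ≃ₗ[F] W) l' = l) :
    FixedBy π L (ω g v) := by
  intro l hl
  obtain ⟨l', hl', rfl⟩ := hg l hl
  have := hω g ⟨l', 0⟩ v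
  rw [hv l' hl'] at this
  exact this.symm

/-- An element of order three of the stabilizer of a Lagrangian subspace which is conjugate to its
inverse there acts trivially on the line of fixed vectors. -/
lemma FixedBy.apply_eq_self [Finite W] (hπ : IsHeisenbergRep ψ π) (hω : Implements π ω)
    (hB : B.IsAlt) (h2 : (2 : F) ≠ 0) (hψ : ψ ≠ 1) {L : Submodule F W}
    (hL : ∀ w, (∀ l ∈ L, B l w = 0) → w ∈ L) {v : E} (hv : FixedBy π L v)
    {u s : SpGroup B} (hu : ∀ l ∈ L, (u : W ≃ₗ[F] W) l = l)
    (hs : ∀ l ∈ L, ∃ l' ∈ L, (s : W ≃ₗ[F] W) l' = l)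
    (hsu : u * s * u = s) (hu3 : u ^ 3 = 1) : ω u v = v := by
  by_cases hv0 : v = 0
  · rw [hv0, map_zero]
  obtain ⟨a, ha⟩ := hv.exists_eq_smul hπ hB h2 hψ hL hv0
    (hv.map hω (g := u) fun l hl => ⟨l, hl, hu l hl⟩)
  obtain ⟨b, hb⟩ := hv.exists_eq_smul hπ hB h2 hψ hL hv0 (hv.map hω hs)
  have h3 : ω (u ^ 3) v = v := by rw [hu3, map_one, Module.End.one_apply]
  have h4 : ω (u * s * u) v = ω s v := by rw [hsu]
  simp only [map_mul, Module.End.mul_apply, pow_succ, pow_zero, ha, hb, map_smul,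
    smul_smul] at h3 h4
  have hb0 : b ≠ 0 := by
    rintro rfl
    rw [zero_smul] at hb
    apply hv0
    have : ω (s⁻¹ * s) v = 0 := by rw [map_mul, Module.End.mul_apply, hb, map_zero]
    simpa using this
  have h3' : a * a * a = 1 := smul_left_injective ℂ hv0 (by simpa [one_mul, mul_assoc] using h3)
  have h4' : a * b * a = b := smul_left_injective ℂ hv0 (by
    simpa [mul_comm, mul_left_comm, mul_assoc] using h4)
  have h5 : a * a = 1 := mul_right_cancel₀ hb0 (by linear_combination h4')
  have h6 : a = 1 := by linear_combination h3' - a * h5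
  rw [ha, h6, one_smul]

end Fixed

variable {p₁ : W →ₗ[F] W₁} {p₂ : W →ₗ[F] W₂}
  {hp : ∀ a b, B a b = B₁ (p₁ a) (p₁ b) + B₂ (p₂ a) (p₂ b)}
  {π : Representation ℂ (Heisenberg B) E}
  {π₁ : Representation ℂ (Heisenberg B₁) E₁} {π₂ : Representation ℂ (Heisenberg B₂) E₂}
  {ω : Representation ℂ (SpGroup B) E}
  {ω₁ : Representation ℂ (SpGroup B₁) E₁} {ω₂ : Representation ℂ (SpGroup B₂) E₂}

/-- On a group acting compatibly on an orthogonal sum and on its summands, the tensor product of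
the oscillator representations agrees up to a character with the oscillator representation of the
sum. -/
theorem exists_character [Finite F] [Finite W] (hπ : IsHeisenbergRep ψ π)
    (hc₁ : HasCentralChar ψ π₁) (hc₂ : HasCentralChar ψ π₂)
    (hω : Implements π ω) (hω₁ : Implements π₁ ω₁) (hω₂ : Implements π₂ ω₂)
    (T : (heisenbergTensor p₁ p₂ hp hc₁ hc₂).Equiv π)
    {G : Type*} [Group G] (φ : G →* SpGroup B) (φ₁ : G →* SpGroup B₁) (φ₂ : G →* SpGroup B₂)
    (h₁ : ∀ g w, p₁ ((φ g : W ≃ₗ[F] W) w) = (φ₁ g : W₁ ≃ₗ[F] W₁) (p₁ w))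
    (h₂ : ∀ g w, p₂ ((φ g : W ≃ₗ[F] W) w) = (φ₂ g : W₂ ≃ₗ[F] W₂) (p₂ w)) :
    ∃ χ : G →* ℂ, ∀ g x,
      T (TensorProduct.map (ω₁ (φ₁ g)) (ω₂ (φ₂ g)) x) = χ g • ω (φ g) (T x) := by
  have := hπ.irreducible.nontrivial
  have hT : ∀ h x, T (heisenbergTensor p₁ p₂ hp hc₁ hc₂ h x) = π h (T x) :=
    fun h x => Representation.IntertwiningMap.isIntertwining _ _ T.toIntertwiningMap h x
  -- `ω₁ ⊗ ω₂` implements the action of `φ g` on the Heisenberg group of the sum, just as `ω` does.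
  have hm : ∀ g h x, TensorProduct.map (ω₁ (φ₁ g)) (ω₂ (φ₂ g))
      (heisenbergTensor p₁ p₂ hp hc₁ hc₂ h x) =
      heisenbergTensor p₁ p₂ hp hc₁ hc₂ (Heisenberg.act (φ g) h)
        (TensorProduct.map (ω₁ (φ₁ g)) (ω₂ (φ₂ g)) x) := by
    intro g h x
    induction x using TensorProduct.induction_on with
    | zero => simp
    | add x y hx hy => simp only [map_add, hx, hy]
    | tmul x y =>
      simp only [heisenbergTensor, MonoidHom.coe_mk, OneHom.coe_mk, LinearMap.smul_apply,
        map_smul, TensorProduct.map_tmul, Heisenberg.act, h₁, h₂]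
      rw [hω₁, hω₂]
      rfl
  have key : ∀ g, ∃ c : ℂ, ∀ x,
      T (TensorProduct.map (ω₁ (φ₁ g)) (ω₂ (φ₂ g)) x) = c • ω (φ g) (T x) := by
    intro g
    -- The quotient of the two implementing operators, transported to `E` by `T`, commutes with `π`.
    obtain ⟨c, hc⟩ := hπ.irreducible.exists_scalar
      (ω (φ g)⁻¹ ∘ₗ T.toLinearEquiv.toLinearMap ∘ₗ
        TensorProduct.map (ω₁ (φ₁ g)) (ω₂ (φ₂ g)) ∘ₗ T.toLinearEquiv.symm.toLinearMap)
      (fun h v => by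
        obtain ⟨x, rfl⟩ := T.toLinearEquiv.surjective v
        have e1 : π h (T.toLinearEquiv x) =
            T.toLinearEquiv (heisenbergTensor p₁ p₂ hp hc₁ hc₂ h x) := (hT h x).symm
        rw [e1]
        simp only [LinearMap.comp_apply, LinearEquiv.coe_coe, LinearEquiv.symm_apply_apply]
        rw [hm]
        have e2 := hT (Heisenberg.act (φ g) h) (TensorProduct.map (ω₁ (φ₁ g)) (ω₂ (φ₂ g)) x)
        change ω (φ g)⁻¹ (T _) = _
        rw [e2, hω]
        congr 1
        ext
        simp [Heisenberg.act])
    refine ⟨c, fun x => ?_⟩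
    have := congrArg (ω (φ g)) (hc (T x))
    rw [map_smul] at this
    rw [← this]
    have e3 : T.toLinearEquiv.symm (T x) = x := T.toLinearEquiv.symm_apply_apply x
    simp only [LinearMap.comp_apply, LinearEquiv.coe_coe, e3]
    rw [← Module.End.mul_apply, ← map_mul, mul_inv_cancel, map_one]
    rfl
  choose χ hχ using key
  obtain ⟨v, hv⟩ := exists_ne (0 : E)
  obtain ⟨x, rfl⟩ := T.toLinearEquiv.surjective v
  have hinj : ∀ g, ω (φ g) (T x) ≠ 0 := by
    intro g h
    apply hv
    have : ω ((φ g)⁻¹ * φ g) (T x) = 0 := by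
      rw [map_mul, Module.End.mul_apply, h, map_zero]
    simpa using this
  refine ⟨{ toFun := χ, map_one' := ?_, map_mul' := fun a b => ?_ }, hχ⟩
  · apply smul_left_injective ℂ (hinj 1)
    simp only [← hχ]
    simp [Module.End.one_eq_id]
  · apply smul_left_injective ℂ (hinj (a * b))
    simp only [← hχ]
    rw [map_mul φ₁, map_mul φ₂, map_mul ω₁, map_mul ω₂, Module.End.mul_eq_comp,
      Module.End.mul_eq_comp, TensorProduct.map_comp, LinearMap.comp_apply, hχ, hχ, map_smul,
      smul_smul, map_mul φ, map_mul ω, Module.End.mul_apply]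

end Oscillator

/-! ### The symplectic space `U ⊗ V`, its Lagrangians `U ⊗ e`, and similitudes. -/

section TensorForm

variable {F U : Type*} [Field F] [AddCommGroup U] [Module F U] {β : LinearMap.BilinForm F U}

@[simp]
lemma tensorForm_tmul (x y : U) (v w : Fin 2 → F) :
    tensorForm β (x ⊗ₜ v) (y ⊗ₜ w) = sympV F v w * β x y := by
  simp [tensorForm]

@[simp]
lemma slToSp_tmul (g : Matrix.SpecialLinearGroup (Fin 2) F) (x : U) (v : Fin 2 → F) :
    (slToSp β g : U ⊗[F] (Fin 2 → F) ≃ₗ[F] U ⊗[F] (Fin 2 → F)) (x ⊗ₜ v) =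
      x ⊗ₜ Matrix.SpecialLinearGroup.toLin' g v := rfl

/-- Symmetric tensor alternating is antisymmetric, and 2 is invertible. -/
lemma tensorForm_isAlt (h2 : (2 : F) ≠ 0) (hβ : ∀ x y, β x y = β y x) : (tensorForm β).IsAlt := by
  have h : ∀ a b, tensorForm β a b = -tensorForm β b a := by
    intro a b
    induction a using TensorProduct.induction_on with
    | zero => simp
    | add a a' ha ha' => simp only [map_add, LinearMap.add_apply, ha, ha', neg_add]
    | tmul x v =>
      induction b using TensorProduct.induction_on with
      | zero => simp
      | add b b' hb hb' => simp only [map_add, LinearMap.add_apply, hb, hb', neg_add]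
      | tmul y w =>
        rw [tensorForm_tmul, tensorForm_tmul, hβ y x, sympV_apply, sympV_apply]
        ring
  intro a
  have := h a a
  have h0 : (2 : F) * tensorForm β a a = 0 := by linear_combination this
  exact (mul_eq_zero.1 h0).resolve_left h2

lemma exists_tmul_add_tmul {i j : Fin 2} (hij : i ≠ j) (w : U ⊗[F] (Fin 2 → F)) :
    ∃ x y, w = x ⊗ₜ Pi.single i 1 + y ⊗ₜ Pi.single j 1 := by
  induction w using TensorProduct.induction_on with
  | zero => exact ⟨0, 0, by simp⟩
  | add w w' hw hw' =>
    obtain ⟨x, y, rfl⟩ := hw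
    obtain ⟨x', y', rfl⟩ := hw'
    exact ⟨x + x', y + y', by simp only [TensorProduct.add_tmul]; abel⟩
  | tmul x v =>
    refine ⟨v i • x, v j • x, ?_⟩
    rw [TensorProduct.smul_tmul, TensorProduct.smul_tmul, ← TensorProduct.tmul_add]
    congr 1
    ext k
    fin_cases i <;> fin_cases j <;> fin_cases k <;> simp at hij ⊢

lemma sympV_single_ne_zero {i j : Fin 2} (hij : i ≠ j) :
    sympV F (Pi.single i 1) (Pi.single j 1) ≠ 0 := by
  fin_cases i <;> fin_cases j <;> simp [sympV_apply] at hij ⊢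

lemma sympV_self (v : Fin 2 → F) : sympV F v v = 0 := by
  rw [sympV_apply]; ring

/-- The subspace `U ⊗ v` of `U ⊗ V`. -/
def tensorVec (U : Type*) [AddCommGroup U] [Module F U] (v : Fin 2 → F) :
    Submodule F (U ⊗[F] (Fin 2 → F)) :=
  LinearMap.range ((TensorProduct.mk F U (Fin 2 → F)).flip v)

lemma mem_tensorVec {v : Fin 2 → F} {w : U ⊗[F] (Fin 2 → F)} :
    w ∈ tensorVec U v ↔ ∃ x, x ⊗ₜ v = w := Iff.rfl

/-- `U ⊗ e` is Lagrangian when `e` is a basis vector and `β` is nondegenerate. -/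
lemma mem_tensorVec_of_orthogonal (hnd : ∀ x, x ≠ 0 → ∃ y, β y x ≠ 0) {i j : Fin 2} (hij : i ≠ j)
    {w : U ⊗[F] (Fin 2 → F)} (hw : ∀ l ∈ tensorVec U (Pi.single i 1), tensorForm β l w = 0) :
    w ∈ tensorVec U (Pi.single i 1) := by
  obtain ⟨x, y, rfl⟩ := exists_tmul_add_tmul hij w
  by_cases hy : y = 0
  · exact ⟨x, by simp [hy]⟩
  · obtain ⟨z, hz⟩ := hnd y hy
    have := hw _ ⟨z, rfl⟩
    simp [sympV_self, sympV_single_ne_zero hij, hz] at this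

/-- A vector orthogonal to everything lies in the Lagrangian `U ⊗ e₀`, and its pairing with `U ⊗ e₁`
is then given by `β`. -/
lemma tensorForm_nondegenerate (hnd : ∀ x, x ≠ 0 → ∃ y, β y x ≠ 0) (w : U ⊗[F] (Fin 2 → F))
    (hw : w ≠ 0) : ∃ w', tensorForm β w' w ≠ 0 := by
  by_contra! h
  obtain ⟨x, hx⟩ := mem_tensorVec.1
    (mem_tensorVec_of_orthogonal hnd (i := 0) (j := 1) (by decide) fun l _ => h l)
  by_cases hx0 : x = 0
  · exact hw (by rw [← hx, hx0, TensorProduct.zero_tmul])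
  · obtain ⟨z, hz⟩ := hnd x hx0
    have := h (z ⊗ₜ Pi.single 1 1)
    rw [← hx, tensorForm_tmul] at this
    exact mul_ne_zero (sympV_single_ne_zero (by decide)) hz this

lemma lineForm_apply (c x y : F) : lineForm c x y = c * (x * y) := by
  simp [lineForm]

/-- The projection to `F ⊗ V` attached to a functional on `U`. -/
def tensorProj (q : U →ₗ[F] F) : U ⊗[F] (Fin 2 → F) →ₗ[F] F ⊗[F] (Fin 2 → F) :=
  q.rTensor _

lemma tensorProj_slToSp (q : U →ₗ[F] F) (c : F) (g : Matrix.SpecialLinearGroup (Fin 2) F)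
    (w : U ⊗[F] (Fin 2 → F)) :
    tensorProj q ((slToSp β g : U ⊗[F] (Fin 2 → F) ≃ₗ[F] U ⊗[F] (Fin 2 → F)) w) =
      (slToSp (lineForm c) g : F ⊗[F] (Fin 2 → F) ≃ₗ[F] F ⊗[F] (Fin 2 → F)) (tensorProj q w) := by
  induction w using TensorProduct.induction_on with
  | zero => simp
  | add w w' hw hw' => simp only [map_add, hw, hw']
  | tmul x v => simp [tensorProj]

variable {a₁ a₂ : F} (q : U ≃ₗ[F] F × F)

lemma tensorForm_eq_add
    (hq : ∀ x y, β x y = a₁ * ((q x).1 * (q y).1) + a₂ * ((q x).2 * (q y).2))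
    (a b : U ⊗[F] (Fin 2 → F)) :
    tensorForm β a b =
      tensorForm (lineForm a₁) (tensorProj (LinearMap.fst F F F ∘ₗ q.toLinearMap) a)
        (tensorProj (LinearMap.fst F F F ∘ₗ q.toLinearMap) b) +
      tensorForm (lineForm a₂) (tensorProj (LinearMap.snd F F F ∘ₗ q.toLinearMap) a)
        (tensorProj (LinearMap.snd F F F ∘ₗ q.toLinearMap) b) := by
  induction a using TensorProduct.induction_on with
  | zero => simp
  | add a a' ha ha' =>
    simp only [map_add, LinearMap.add_apply, ha, ha']
    ring
  | tmul x v =>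
    induction b using TensorProduct.induction_on with
    | zero => simp
    | add b b' hb hb' =>
      simp only [map_add, hb, hb']
      ring
    | tmul y w =>
      simp only [tensorProj, LinearMap.rTensor_tmul, tensorForm_tmul, hq, lineForm_apply,
        LinearMap.comp_apply, LinearEquiv.coe_coe, LinearMap.fst_apply, LinearMap.snd_apply]
      ring

lemma tensorProj_surjective (a b : F ⊗[F] (Fin 2 → F)) :
    ∃ w, tensorProj (LinearMap.fst F F F ∘ₗ q.toLinearMap) w = a ∧
      tensorProj (LinearMap.snd F F F ∘ₗ q.toLinearMap) w = b := by
  obtain ⟨x, y, rfl⟩ := exists_tmul_add_tmul (i := 0) (j := 1) (by decide) a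
  obtain ⟨z, t, rfl⟩ := exists_tmul_add_tmul (i := 0) (j := 1) (by decide) b
  exact ⟨q.symm (x, z) ⊗ₜ Pi.single 0 1 + q.symm (y, t) ⊗ₜ Pi.single 1 1, by simp [tensorProj]⟩

/-- The product of similitudes of `U` and `V` of multiplier `-1`, as an element of `Sp(U ⊗ V)`. -/
def similitude (A : U ≃ₗ[F] U) (hA : ∀ x y, β (A x) (A y) = -β x y) : SpGroup (tensorForm β) :=
  ⟨TensorProduct.congr A (LinearEquiv.piCongrRight ![LinearEquiv.refl F F, LinearEquiv.neg F]), by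
    intro a b
    induction a using TensorProduct.induction_on with
    | zero => simp
    | add a a' ha ha' => simp only [map_add, LinearMap.add_apply, ha, ha']
    | tmul x v =>
      induction b using TensorProduct.induction_on with
      | zero => simp
      | add b b' hb hb' => simp only [map_add, hb, hb']
      | tmul y w =>
        simp only [TensorProduct.congr_tmul, tensorForm_tmul, hA, sympV_apply]
        simp
        ring⟩

lemma similitude_tmul (A : U ≃ₗ[F] U) (hA : ∀ x y, β (A x) (A y) = -β x y) (x : U)
    (v : Fin 2 → F) :
    (similitude A hA : U ⊗[F] (Fin 2 → F) ≃ₗ[F] U ⊗[F] (Fin 2 → F)) (x ⊗ₜ v) =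
      A x ⊗ₜ ![v 0, -v 1] := by
  change A x ⊗ₜ _ = _
  congr 1
  ext k
  fin_cases k <;> simp

lemma spGroup_ext {g h : SpGroup (tensorForm β)}
    (H : ∀ x v, (g : U ⊗[F] (Fin 2 → F) ≃ₗ[F] U ⊗[F] (Fin 2 → F)) (x ⊗ₜ v) =
      (h : U ⊗[F] (Fin 2 → F) ≃ₗ[F] U ⊗[F] (Fin 2 → F)) (x ⊗ₜ v)) : g = h := by
  apply Subtype.ext
  apply LinearEquiv.toLinearMap_injective
  exact TensorProduct.ext' H

lemma toLin'_transvection {i j : Fin 2} (hij : i ≠ j) (c : F) (v : Fin 2 → F) :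
    Matrix.SpecialLinearGroup.toLin' (Matrix.SpecialLinearGroup.transvection hij c) v =
      v + Pi.single i (c * v j) := by
  ext k
  rw [Matrix.SpecialLinearGroup.toLin'_apply, Matrix.toLin'_apply,
    Matrix.SpecialLinearGroup.transvection_coe, Matrix.add_mulVec, Matrix.one_mulVec,
    Matrix.single_mulVec_eq]
  by_cases h : k = i
  · subst h; simp
  · simp [h]

/-- `diag(1, -1)` conjugates a transvection of `V` to its inverse, while `A` acts on the other
factor and commutes with it. -/
lemma transvection_mul_similitude_mul (A : U ≃ₗ[F] U) (hA : ∀ x y, β (A x) (A y) = -β x y)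
    {i j : Fin 2} (hij : i ≠ j) (c : F) :
    slToSp β (Matrix.SpecialLinearGroup.transvection hij c) * similitude A hA *
      slToSp β (Matrix.SpecialLinearGroup.transvection hij c) = similitude A hA := by
  apply spGroup_ext
  intro x v
  simp only [Subgroup.coe_mul, LinearEquiv.mul_apply, slToSp_tmul, similitude_tmul,
    toLin'_transvection]
  congr 1
  ext k
  fin_cases i <;> fin_cases j <;> fin_cases k <;> simp at hij ⊢

lemma transvection_pow_three (h3 : (3 : F) = 0) {i j : Fin 2} (hij : i ≠ j) (c : F) :
    (Matrix.SpecialLinearGroup.transvection hij c) ^ 3 = 1 := by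
  have h : c + (c + c) = 0 := by linear_combination c * h3
  ext k l
  fin_cases i <;> fin_cases j <;> fin_cases k <;> fin_cases l <;>
    simp [Matrix.SpecialLinearGroup.transvection_coe, pow_succ, Matrix.mul_apply,
      Fin.sum_univ_two, Matrix.add_apply, Matrix.single, add_assoc, h] at hij ⊢

/-- The exchange of coordinates, or `(x, y) ↦ (x + y, x - y)` in characteristic three. -/
lemma exists_similitude (h3 : (3 : F) = 0) (ha : a₁ = a₂ ∨ a₁ = -a₂)
    (hq : ∀ x y, β x y = a₁ * ((q x).1 * (q y).1) + a₂ * ((q x).2 * (q y).2)) :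
    ∃ A : U ≃ₗ[F] U, ∀ x y, β (A x) (A y) = -β x y := by
  rcases ha with rfl | rfl
  · let f : F × F →ₗ[F] F × F :=
      (LinearMap.fst F F F + LinearMap.snd F F F).prod (LinearMap.fst F F F - LinearMap.snd F F F)
    have hf : ∀ x, f x = (x.1 + x.2, x.1 - x.2) := fun x => rfl
    -- `f² = 2 = -1` in characteristic three, so the inverse of `f` is `-f`; likewise `f` multiplies
    -- the form `x² + y²` by `2 = -1`.
    let A : (F × F) ≃ₗ[F] F × F := LinearEquiv.ofLinearMap f (-f)
      (by
        ext <;> simp [hf] <;> linear_combination -h3)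
      (by
        ext <;> simp [hf] <;> linear_combination -h3)
    have hA : ∀ x, A x = (x.1 + x.2, x.1 - x.2) := fun x => rfl
    refine ⟨q.trans (A.trans q.symm), fun x y => ?_⟩
    rw [hq, hq]
    simp only [LinearEquiv.trans_apply, LinearEquiv.apply_symm_apply, hA]
    linear_combination (a₁ * ((q x).1 * (q y).1) + a₁ * ((q x).2 * (q y).2)) * h3
  · refine ⟨q.trans ((LinearEquiv.prodComm F F F).trans q.symm), fun x y => ?_⟩
    rw [hq, hq]
    simp only [LinearEquiv.trans_apply, LinearEquiv.apply_symm_apply,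
      LinearEquiv.prodComm_apply, Prod.fst_swap, Prod.snd_swap]
    ring

end TensorForm

/-! ### Triviality of the character, and diagonalization over a finite field. -/

section Decomposition

variable {F : Type*} [Field F]

lemma two_ne_zero_of_odd_card [Finite F] (hF : Odd (Nat.card F)) : (2 : F) ≠ 0 := by
  cases nonempty_fintype F
  rw [Nat.card_eq_fintype_card] at hF
  have h := FiniteField.odd_card_of_char_ne_two (F := F)
  intro h2
  have hch : ringChar F = 2 := by
    have := (ringChar.spec F 2).1 (by exact_mod_cast h2)
    exact (Nat.dvd_prime Nat.prime_two).1 this |>.resolve_left CharP.ringChar_ne_one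
  have := FiniteField.even_card_of_char_two hch
  rw [Nat.odd_iff] at hF
  omega

lemma three_eq_zero_of_card [Finite F] (h : Nat.card F = 3) : (3 : F) = 0 := by
  cases nonempty_fintype F
  rw [Nat.card_eq_fintype_card] at h
  have := FiniteField.cast_card_eq_zero F
  rw [h] at this
  exact_mod_cast this

/-- Unless `F` has three elements, it has a nonzero element with square different from `1`. -/
lemma exists_sq_ne_one [Finite F] (hF : Odd (Nat.card F)) (h3 : Nat.card F ≠ 3) :
    ∃ a : F, a ≠ 0 ∧ a ^ 2 ≠ 1 := by
  classical
  cases nonempty_fintype F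
  rw [Nat.card_eq_fintype_card] at hF h3
  by_contra! h
  have hsub : (Finset.univ : Finset F) ⊆ {0, 1, -1} := by
    intro a _
    by_cases ha : a = 0
    · simp [ha]
    · rcases sq_eq_sq_iff_eq_or_eq_neg.1 ((h a ha).trans (one_pow 2).symm) with h | h <;> simp [h]
  have h1 := Finset.card_le_card hsub
  have h2 : ({0, 1, -1} : Finset F).card ≤ 3 := Finset.card_le_three
  have h4 := Fintype.one_lt_card (α := F)
  rw [Finset.card_univ] at h1
  rcases hF with ⟨k, hk⟩
  omega

lemma eq_or_eq_neg_of_card_eq_three [Finite F] (h : Nat.card F = 3) {a b : F} (ha : a ≠ 0)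
    (hb : b ≠ 0) : a = b ∨ a = -b := by
  cases nonempty_fintype F
  rw [Nat.card_eq_fintype_card] at h
  apply sq_eq_sq_iff_eq_or_eq_neg.1
  have h1 : ∀ x : F, x ≠ 0 → x ^ 2 = 1 := fun x hx => by
    have := FiniteField.pow_card_sub_one_eq_one x hx
    rwa [h] at this
  rw [h1 a ha, h1 b hb]

variable {U : Type*} [AddCommGroup U] [Module F U] {β : LinearMap.BilinForm F U}
  {E E₁ E₂ : Type*} [AddCommGroup E] [Module ℂ E]
  [AddCommGroup E₁] [Module ℂ E₁] [AddCommGroup E₂] [Module ℂ E₂] {ψ : AddChar F ℂ} {a₁ a₂ : F}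

lemma lineForm_nondegenerate {c : F} (hc : c ≠ 0) (x : F) (hx : x ≠ 0) :
    ∃ y, lineForm c y x ≠ 0 :=
  ⟨1, by simpa [lineForm_apply] using ⟨hc, hx⟩⟩

lemma lineForm_comm (c x y : F) : lineForm c x y = lineForm c y x := by
  rw [lineForm_apply, lineForm_apply, mul_comm x]

lemma tensorForm_eq_zero_of_mem_tensorVec {v : Fin 2 → F} {a b : U ⊗[F] (Fin 2 → F)}
    (ha : a ∈ tensorVec U v) (hb : b ∈ tensorVec U v) : tensorForm β a b = 0 := by
  obtain ⟨x, rfl⟩ := mem_tensorVec.1 ha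
  obtain ⟨y, rfl⟩ := mem_tensorVec.1 hb
  rw [tensorForm_tmul, sympV_self, zero_mul]

lemma tensorProj_mem_tensorVec (q : U →ₗ[F] F) {v : Fin 2 → F} {w : U ⊗[F] (Fin 2 → F)}
    (hw : w ∈ tensorVec U v) : tensorProj q w ∈ tensorVec F v := by
  obtain ⟨x, rfl⟩ := mem_tensorVec.1 hw
  exact ⟨q x, by simp [tensorProj]⟩

lemma toLin'_transvection_single {i j : Fin 2} (hij : i ≠ j) (c : F) :
    Matrix.SpecialLinearGroup.toLin' (Matrix.SpecialLinearGroup.transvection hij c)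
      (Pi.single i 1) = Pi.single i 1 := by
  rw [toLin'_transvection]
  simp [hij.symm]

lemma slToSp_transvection_apply {i j : Fin 2} (hij : i ≠ j) (c : F) {w : U ⊗[F] (Fin 2 → F)}
    (hw : w ∈ tensorVec U (Pi.single i 1)) :
    (slToSp β (Matrix.SpecialLinearGroup.transvection hij c) :
      U ⊗[F] (Fin 2 → F) ≃ₗ[F] U ⊗[F] (Fin 2 → F)) w = w := by
  obtain ⟨x, rfl⟩ := mem_tensorVec.1 hw
  rw [slToSp_tmul, toLin'_transvection_single]

/-- If `#F = 3`, the canonical oscillator representation on `F ⊗ V` is such that a transvection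
fixes the vectors which are fixed by its axis. -/
lemma transvection_apply_of_fixedBy
    {π₁ : Representation ℂ (Heisenberg (tensorForm (lineForm a₁))) E₁}
    {ω₁ : Representation ℂ (SpGroup (tensorForm (lineForm a₁))) E₁} (h3 : Nat.card F = 3)
    (h : Nat.card F = 3 → Module.finrank F (F ⊗[F] (Fin 2 → F)) = 2 →
      ∀ (g : SpGroup (tensorForm (lineForm a₁))) (w : F ⊗[F] (Fin 2 → F)) (v : E₁), w ≠ 0 →
        (g : F ⊗[F] (Fin 2 → F) ≃ₗ[F] F ⊗[F] (Fin 2 → F)) w = w → π₁ ⟨w, 0⟩ v = v → ω₁ g v = v)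
    {i j : Fin 2} (hij : i ≠ j) (c : F) {v : E₁} (hv : FixedBy π₁ (tensorVec F (Pi.single i 1)) v) :
    ω₁ (slToSp (lineForm a₁) (Matrix.SpecialLinearGroup.transvection hij c)) v = v := by
  have hw : (1 : F) ⊗ₜ[F] (Pi.single i 1 : Fin 2 → F) ∈ tensorVec F (Pi.single i 1 : Fin 2 → F) :=
    ⟨1, rfl⟩
  refine h h3 (by simp) _ ((1 : F) ⊗ₜ Pi.single i 1) v ?_ (slToSp_transvection_apply hij c hw)
    (hv _ hw)
  intro h0
  have := congrArg (TensorProduct.lid F (Fin 2 → F)) h0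
  simp at this

/-- The restriction to `SL₂` of the oscillator representation attached to a diagonal plane is the
tensor product of those attached to the diagonal entries. -/
theorem exists_equiv_tprod [Finite F] (hF : Odd (Nat.card F)) (hψ : ψ ≠ 1)
    (ha₁ : a₁ ≠ 0) (ha₂ : a₂ ≠ 0) (q : U ≃ₗ[F] F × F)
    (hq : ∀ x y, β x y = a₁ * ((q x).1 * (q y).1) + a₂ * ((q x).2 * (q y).2))
    {ω : Representation ℂ (SpGroup (tensorForm β)) E} (hω : IsOscillatorRep ψ ω)
    {ω₁ : Representation ℂ (SpGroup (tensorForm (lineForm a₁))) E₁} (hω₁ : IsOscillatorRep ψ ω₁)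
    {ω₂ : Representation ℂ (SpGroup (tensorForm (lineForm a₂))) E₂} (hω₂ : IsOscillatorRep ψ ω₂) :
    Nonempty ((resSL ω).Equiv ((resSL ω₁).tprod (resSL ω₂))) := by
  obtain ⟨π, hπ, himp, -⟩ := hω
  obtain ⟨π₁, hπ₁, himp₁, hcan₁⟩ := hω₁
  obtain ⟨π₂, hπ₂, himp₂, hcan₂⟩ := hω₂
  replace himp := implements_of_conj himp
  replace himp₁ := implements_of_conj himp₁
  replace himp₂ := implements_of_conj himp₂
  have h2 := two_ne_zero_of_odd_card hF
  have : Module.Finite F U := Module.Finite.equiv q.symm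
  have : Finite (U ⊗[F] (Fin 2 → F)) := Module.finite_of_finite F
  have : Finite (F ⊗[F] (Fin 2 → F)) := Module.finite_of_finite F
  have hnd : ∀ x, x ≠ 0 → ∃ y, β y x ≠ 0 := by
    intro x hx
    by_contra! h
    have e1 := h (q.symm (1, 0))
    have e2 := h (q.symm (0, 1))
    simp only [hq, LinearEquiv.apply_symm_apply, one_mul, zero_mul, mul_zero, add_zero, zero_add,
      mul_eq_zero, ha₁, ha₂, false_or] at e1 e2
    exact hx (q.injective (by rw [map_zero]; exact Prod.ext e1 e2))
  have hsymm : ∀ x y, β x y = β y x := fun x y => by rw [hq, hq]; ring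
  have hB := tensorForm_isAlt h2 hsymm
  have hB₁ := tensorForm_isAlt h2 (lineForm_comm a₁)
  have hB₂ := tensorForm_isAlt h2 (lineForm_comm a₂)
  have hnd₁ := tensorForm_nondegenerate (lineForm_nondegenerate ha₁)
  have hnd₂ := tensorForm_nondegenerate (lineForm_nondegenerate ha₂)
  obtain ⟨T⟩ := hπ.exists_equiv (heisenbergTensor_isHeisenbergRep (hp := tensorForm_eq_add q hq)
    (tensorProj_surjective q) hπ₁ hπ₂ hB₁ h2 hψ hnd₁) hB h2 hψ (tensorForm_nondegenerate hnd)
  obtain ⟨χ, hχ⟩ := exists_character hπ hπ₁.central hπ₂.central himp himp₁ himp₂ T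
    (slToSp β) (slToSp (lineForm a₁)) (slToSp (lineForm a₂))
    (tensorProj_slToSp _ a₁) (tensorProj_slToSp _ a₂)
  suffices h1 : ∀ g, χ g = 1 by
    refine ⟨(Representation.Equiv.mk T.toLinearEquiv fun g => ?_).symm⟩
    refine LinearMap.ext fun x => ?_
    have := hχ g x
    rw [h1, one_smul] at this
    exact this
  -- `SL₂(𝔽₃)` is not perfect, so for `q = 3` the character has to be computed on transvections.
  by_cases h3 : Nat.card F = 3
  · have h30 := three_eq_zero_of_card h3
    obtain ⟨A, hA⟩ := exists_similitude q h30 (eq_or_eq_neg_of_card_eq_three h3 ha₁ ha₂) hq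
    refine fun g => Matrix.SL2.transvection_induction (fun g => χ g = 1) (fun i j hij c => ?_)
      (fun g h hg hh => by rw [map_mul, hg, hh, one_mul]) g
    obtain ⟨v₁, hv₁, hf₁⟩ := exists_fixedBy_ne_zero hπ₁ hB₁ h2 hψ hnd₁
      (tensorVec F (Pi.single i 1)) fun a ha b hb => tensorForm_eq_zero_of_mem_tensorVec ha hb
    obtain ⟨v₂, hv₂, hf₂⟩ := exists_fixedBy_ne_zero hπ₂ hB₂ h2 hψ hnd₂
      (tensorVec F (Pi.single i 1)) fun a ha b hb => tensorForm_eq_zero_of_mem_tensorVec ha hb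
    have hv : v₁ ⊗ₜ[ℂ] v₂ ≠ 0 := by
      intro h0
      refine hv₁ ((Module.forall_dual_apply_eq_zero_iff ℂ v₁).1 fun ξ => ?_)
      by_contra hξ
      refine hv₂ ((Module.forall_dual_apply_eq_zero_iff ℂ v₂).1 fun η => ?_)
      have := congrArg (LinearMap.mul' ℂ ℂ ∘ₗ TensorProduct.map ξ η) h0
      simpa [hξ] using this
    have hTv : T (v₁ ⊗ₜ v₂) ≠ 0 := fun h => hv (T.toLinearEquiv.map_eq_zero_iff.1 h)
    -- The projections map `U ⊗ e` into `F ⊗ e`, so `v₁ ⊗ v₂` is fixed factor by factor.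
    have hf : FixedBy π (tensorVec U (Pi.single i 1)) (T (v₁ ⊗ₜ v₂)) := by
      intro w hw
      have := Representation.IntertwiningMap.isIntertwining _ _ T.toIntertwiningMap ⟨w, 0⟩ (v₁ ⊗ₜ v₂)
      rw [heisenbergTensor_vec (hp := tensorForm_eq_add q hq) hπ₁.central hπ₂.central,
        TensorProduct.map_tmul, hf₁ _ (tensorProj_mem_tensorVec _ hw),
        hf₂ _ (tensorProj_mem_tensorVec _ hw)] at this
      exact this.symm
    -- Here `U ⊗ V` has dimension 4, so the normalization clause says nothing about `ω`; the
    -- similitude inverting the transvection takes its place.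
    have hfix := hf.apply_eq_self hπ himp hB h2 hψ
      (fun w hw => mem_tensorVec_of_orthogonal hnd hij hw)
      (u := slToSp β (Matrix.SpecialLinearGroup.transvection hij c)) (s := similitude A hA)
      (fun l hl => slToSp_transvection_apply hij c hl)
      (fun l hl => by
        obtain ⟨x, rfl⟩ := mem_tensorVec.1 hl
        -- `diag(1, -1)` sends the basis vector to itself or its negative, so the similitude
        -- preserves `U ⊗ e`.
        have hsq : (![(Pi.single i 1 : Fin 2 → F) 0, -(Pi.single i 1 : Fin 2 → F) 1]) =
            (Pi.single i 1 : Fin 2 → F) ∨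
            (![(Pi.single i 1 : Fin 2 → F) 0, -(Pi.single i 1 : Fin 2 → F) 1]) =
            -(Pi.single i 1 : Fin 2 → F) := by
          fin_cases i
          · left; ext k; fin_cases k <;> simp
          · right; ext k; fin_cases k <;> simp
        rcases hsq with hsq | hsq
        · exact ⟨A.symm x ⊗ₜ Pi.single i 1, ⟨_, rfl⟩, by
            rw [similitude_tmul, hsq, LinearEquiv.apply_symm_apply]⟩
        · exact ⟨A.symm (-x) ⊗ₜ Pi.single i 1, ⟨_, rfl⟩, by
            rw [similitude_tmul, hsq, LinearEquiv.apply_symm_apply, TensorProduct.tmul_neg,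
              TensorProduct.neg_tmul, neg_neg]⟩)
      (transvection_mul_similitude_mul A hA hij c)
      (by rw [← map_pow, transvection_pow_three h30, map_one])
    have h := hχ (Matrix.SpecialLinearGroup.transvection hij c) (v₁ ⊗ₜ v₂)
    rw [hfix, TensorProduct.map_tmul, transvection_apply_of_fixedBy h3 hcan₁ hij c hf₁,
      transvection_apply_of_fixedBy h3 hcan₂ hij c hf₂] at h
    exact smul_left_injective ℂ hTv (by simpa using h.symm)
  -- An `a ≠ 0` with `a² ≠ 1` makes `SL₂(F)` perfect, and `χ` takes values in the commutative group
  -- `ℂˣ`.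
  · obtain ⟨a, ha, hasq⟩ := exists_sq_ne_one hF h3
    intro g
    have hg : g ∈ commutator (Matrix.SpecialLinearGroup (Fin 2) F) := by
      rw [Matrix.SL2.commutator_eq_top ha hasq]
      trivial
    have := Abelianization.commutator_subset_ker χ.toHomUnits hg
    exact congrArg Units.val (MonoidHom.mem_ker.1 this)

lemma planeForm_apply (c : F) (x y : Fin 2 → F) :
    planeForm c x y = x 0 * y 0 - c * (x 1 * y 1) := by
  simp [planeForm, Matrix.toBilin'_apply, Fin.sum_univ_two]
  ring

/-- The plane `x² - c y²` is the orthogonal sum of the lines `x²` and `a x²` if `-c = a r²`. -/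
lemma exists_diagonalization {c a r : F} (e : β.IsometryEquiv (planeForm c)) (hr : r ≠ 0)
    (h : -c = a * r ^ 2) :
    ∃ q : U ≃ₗ[F] F × F,
      ∀ x y, β x y = 1 * ((q x).1 * (q y).1) + a * ((q x).2 * (q y).2) := by
  refine ⟨e.toLinearEquiv.trans ((LinearEquiv.finTwoArrow F F).trans
    ((LinearEquiv.refl F F).prodCongr (LinearEquiv.smulOfNeZero F F r hr))), fun x y => ?_⟩
  rw [← e.map_app' x y]
  change planeForm c (e.toLinearEquiv x) (e.toLinearEquiv y) = _
  rw [planeForm_apply]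
  simp only [LinearEquiv.trans_apply, LinearEquiv.prodCongr_apply, LinearEquiv.finTwoArrow_apply,
    LinearEquiv.refl_apply, LinearEquiv.smulOfNeZero_apply, smul_eq_mul]
  linear_combination (e.toLinearEquiv x 1 * e.toLinearEquiv y 1) * h

/-- The quotient of two non-squares of a finite field is a square. -/
lemma exists_eq_mul_sq_of_not_isSquare [Finite F] (h2 : (2 : F) ≠ 0) {a b : F}
    (ha : ¬ IsSquare a) (hb : ¬ IsSquare b) : ∃ r, r ≠ 0 ∧ a = b * r ^ 2 := by
  classical
  cases nonempty_fintype F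
  have hch : ringChar F ≠ 2 := fun h => h2 (by
    have := ringChar.Nat.cast_ringChar (R := F)
    rw [h] at this
    exact_mod_cast this)
  have ha0 : a ≠ 0 := by rintro rfl; exact ha (IsSquare.zero)
  have hb0 : b ≠ 0 := by rintro rfl; exact hb (IsSquare.zero)
  have h1 : quadraticChar F (a * b) = 1 := by
    rw [map_mul, quadraticChar_neg_one_iff_not_isSquare.2 ha,
      quadraticChar_neg_one_iff_not_isSquare.2 hb]
    norm_num
  obtain ⟨s, hs⟩ := (quadraticChar_one_iff_isSquare (mul_ne_zero ha0 hb0)).1 h1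
  have hs0 : s ≠ 0 := by
    rintro rfl
    exact mul_ne_zero ha0 hb0 (by simpa using hs)
  -- From `a * b = s²` follows `a = b (s / b)²`.
  refine ⟨s / b, div_ne_zero hs0 hb0, ?_⟩
  field_simp
  linear_combination hs

end Decomposition

end

theorem proposition4
    {F : Type*} [Field F] [Finite F] (hF : Odd (Nat.card F))
    (ψ : AddChar F ℂ) (hψ : ψ ≠ 1)
    (ε : F) (hε : ¬ IsSquare ε)
    {U : Type*} [AddCommGroup U] [Module F U] (β : LinearMap.BilinForm F U)
    {E Ep Em : Type*} [AddCommGroup E] [Module ℂ E] [AddCommGroup Ep] [Module ℂ Ep]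
    [AddCommGroup Em] [Module ℂ Em]
    (ω : Representation ℂ (SpGroup (tensorForm β)) E) (hω : IsOscillatorRep ψ ω)
    (ωp : Representation ℂ (SpGroup (tensorForm (lineForm (1 : F)))) Ep)
    (hωp : IsOscillatorRep ψ ωp)
    (ωm : Representation ℂ (SpGroup (tensorForm (lineForm ε))) Em)
    (hωm : IsOscillatorRep ψ ωm) :
    (Nonempty (β.IsometryEquiv (planeForm 1)) →
      (Nat.card F % 4 = 1 →
        Nonempty ((resSL ω).Equiv ((resSL ωp).tprod (resSL ωp)))) ∧
      (Nat.card F % 4 = 3 →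
        Nonempty ((resSL ω).Equiv ((resSL ωp).tprod (resSL ωm))))) ∧
    (Nonempty (β.IsometryEquiv (planeForm ε)) →
      (Nat.card F % 4 = 1 →
        Nonempty ((resSL ω).Equiv ((resSL ωp).tprod (resSL ωm)))) ∧
      (Nat.card F % 4 = 3 →
        Nonempty ((resSL ω).Equiv ((resSL ωp).tprod (resSL ωp))))) := by
  have h2 := two_ne_zero_of_odd_card hF
  have hε0 : ε ≠ 0 := by rintro rfl; exact hε IsSquare.zero
  have h1 : Nat.card F % 4 = 1 → ∃ r : F, r ≠ 0 ∧ -1 = r ^ 2 := by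
    intro h
    cases nonempty_fintype F
    rw [Nat.card_eq_fintype_card] at h
    obtain ⟨r, hr⟩ := (FiniteField.isSquare_neg_one_iff (F := F)).2 (by omega)
    exact ⟨r, by rintro rfl; simp at hr, by rw [hr, sq]⟩
  -- Both `-1` and `ε` are non-squares here.
  have h3 : Nat.card F % 4 = 3 → ∃ r : F, r ≠ 0 ∧ -1 = ε * r ^ 2 := by
    intro h
    refine exists_eq_mul_sq_of_not_isSquare h2 (fun hs => ?_) hε
    cases nonempty_fintype F
    rw [Nat.card_eq_fintype_card] at h
    exact FiniteField.isSquare_neg_one_iff.1 hs h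
  refine ⟨fun ⟨e⟩ => ⟨fun h => ?_, fun h => ?_⟩, fun ⟨e⟩ => ⟨fun h => ?_, fun h => ?_⟩⟩
  · obtain ⟨r, hr, hr1⟩ := h1 h
    obtain ⟨q, hq⟩ := exists_diagonalization (a := 1) e hr (by rw [hr1, one_mul])
    exact exists_equiv_tprod hF hψ one_ne_zero one_ne_zero q hq hω hωp hωp
  · obtain ⟨r, hr, hr1⟩ := h3 h
    obtain ⟨q, hq⟩ := exists_diagonalization (a := ε) e hr hr1
    exact exists_equiv_tprod hF hψ one_ne_zero hε0 q hq hω hωp hωm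
  · obtain ⟨r, hr, hr1⟩ := h1 h
    obtain ⟨q, hq⟩ := exists_diagonalization (a := ε) e hr (by linear_combination ε * hr1)
    exact exists_equiv_tprod hF hψ one_ne_zero hε0 q hq hω hωp hωm
  · obtain ⟨r, hr, hr1⟩ := h3 h
    -- Multiplying `-1 = ε r²` by `ε` gives `-ε = (ε r)²`.
    obtain ⟨q, hq⟩ := exists_diagonalization (a := 1) e (mul_ne_zero hε0 hr)
      (by linear_combination ε * hr1)
    exact exists_equiv_tprod hF hψ one_ne_zero one_ne_zero q hq hω hωp hωp
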